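/- Let $M,N\ge 1$ be integers, $\sigma>0$, $|\rho|<1$, $\gamma_{th}\ge 0$, and let $x_{0n},y_{0n},x_{mn},y_{mn}$ ($1\le n\le N$, $2\le m\le M$) be mutually independent real Gaussian random variables with mean $0$ and variance $1/2$. Consider the equally correlated Rayleigh fading channel between an $N$-antenna transmitter and an $M$-port fluid antenna receiver, $$h_{1n}=\sigma x_{0n}+j\sigma y_{0n},\qquad h_{mn}=\sigma\bigl(\sqrt{1-\rho^2}\,x_{mn}+\rho x_{0n}\bigr)+j\sigma\bigl(\sqrt{1-\rho^2}\,y_{mn}+\rho y_{0n}\bigr)\quad(2\le m\le M),$$ and write $\mathbf h_m=(h_{m1},\dots,h_{mN})^T$, $X_m=\sum_{n=1}^N|h_{mn}|^2$ and $X_{\rm FAS}=\max\{X_1,\dots,X_M\}$. For transmit power $P>0$ and noise power $\eta_0^2>0$, maximum ratio transmission $\mathbf w_m=\mathbf h_m^H/\|\mathbf h_m\|$ (with $\mathbf w_m=0$ if $\mathbf h_m=0$) gives the received SNR $\gamma_m=P|\mathbf w_m\mathbf h_m|^2/\eta_0^2$ at port $m$. Put $\gamma_{\rm FAS}=\max_m\gamma_m$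 and $\bar\gamma=P\sigma^2/\eta_0^2$. For $b\ge 0$ let $$Q_N(a,b)=\int_b^\infty u\Bigl(\frac ua\Bigr)^{N-1}e^{-(u^2+a^2)/2}I_{N-1}(au)\,du\quad(a>0),\qquad Q_N(0,b)=\int_b^\infty\frac{u^{2N-1}}{2^{N-1}(N-1)!}e^{-u^2/2}\,du$$ be the generalized Marcum $Q$-function, where $I_k(z)=\sum_{j\ge0}\frac{(z/2)^{2j+k}}{j!\,(j+k)!}$ is the modified Bessel function of the first kind. Then the outage event $\{X_{\rm FAS}<\gamma_{th}\}$ is the event $\{\gamma_{\rm FAS}/\bar\gamma<\gamma_{th}/\sigma^2\}$ for all $P,\eta_0>0$ (so it is $\{\gamma_{\rm FAS}/\bar\gamma<\gamma_{th}\}$ under the normalization $\sigma=1$), the integrand below is integrable on $[0,\gamma_{th}]$, and the outage probability is $$\Pr(X_{\rm FAS}<\gamma_{th})=\int_0^{\gamma_{th}}\frac{t_1^{N-1}}{\sigma^{2N}(N-1)!}\,e^{-t_1/\sigma^2}\left(1-Q_N\!\left(\sqrt{\frac{2\rho^2t_1}{\sigma^2(1-\rho^2)}},\sqrt{\frac{2\gamma_{th}}{\sigma^2(1-\rho^2)}}\right)\right)^{M-1}dt_1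 .$$ -/

import Mathlib

open MeasureTheory ProbabilityTheory

noncomputable section

/-- The channel coefficient `h_{mn}` (port `m`, antenna `n`) of the equally correlated Rayleigh
model.  Port `0 : Fin M` is the first port; the variables `x 0 n`, `y 0 n` drive it and are shared
by all the other ports, and `x m n`, `y m n` with `m ≠ 0` are the private variables of port `m`. -/
def channel {Ω : Type*} {M N : ℕ} [NeZero M] (σ ρ : ℝ) (x y : Fin M → Fin N → Ω → ℝ)
    (ω : Ω) (m : Fin M) (n : Fin N) : ℂ :=
  if m = 0 then
    ((σ * x 0 n ω : ℝ) : ℂ) + Complex.I * ((σ * y 0 n ω : ℝ) : ℂ)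
  else
    ((σ * (√(1 - ρ ^ 2) * x m n ω + ρ * x 0 n ω) : ℝ) : ℂ)
      + Complex.I * ((σ * (√(1 - ρ ^ 2) * y m n ω + ρ * y 0 n ω) : ℝ) : ℂ)

/-- The precoding gain `X = ∑ₙ |hₙ|²` of a port with channel vector `h`. -/
def precodingGain {N : ℕ} (h : Fin N → ℂ) : ℝ :=
  ∑ n, ‖h n‖ ^ 2

/-- The maximum ratio transmission precoder `h^H / ‖h‖` (Euclidean norm). -/
def mrtPrecoder {N : ℕ} (h : Fin N → ℂ) : Fin N → ℂ :=
  fun n => star (h n) / ((‖WithLp.toLp 2 h‖ : ℝ) : ℂ)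

/-- The received SNR `P |w h|² / η₀²` of a port with channel vector `h`, where `w` is the MRT
precoder, `P` the transmit power and `η₀²` the noise power. -/
def receivedSNR {N : ℕ} (P η₀ : ℝ) (h : Fin N → ℂ) : ℝ :=
  P * ‖mrtPrecoder h ⬝ᵥ h‖ ^ 2 / η₀ ^ 2

/-- The average single-branch SNR `P σ² / η₀²`. -/
def averageSNR (P η₀ σ : ℝ) : ℝ :=
  P * σ ^ 2 / η₀ ^ 2

/-- The gain of the fluid antenna system: the largest precoding gain over the `M` ports. -/
def fasGain {M N : ℕ} [NeZero M] (h : Fin M → Fin N → ℂ) : ℝ :=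
  Finset.univ.sup' Finset.univ_nonempty fun m => precodingGain (h m)

/-- The SNR of the fluid antenna system: the largest received SNR over the `M` ports. -/
def fasSNR {M N : ℕ} [NeZero M] (P η₀ : ℝ) (h : Fin M → Fin N → ℂ) : ℝ :=
  Finset.univ.sup' Finset.univ_nonempty fun m => receivedSNR P η₀ (h m)

/-- The modified Bessel function of the first kind `I_k`, of order `k : ℕ`. -/
def besselI (k : ℕ) (z : ℝ) : ℝ :=
  ∑' j : ℕ, (z / 2) ^ (2 * j + k) / ((j.factorial : ℝ) * ((j + k).factorial : ℝ))

/-- The generalized Marcum function `Q_N(a, b)` for an integer order `N ≥ 1` and `a, b ≥ 0`: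
`∫_b^∞ u (u / a)^(N-1) exp(-(u² + a²) / 2) I_{N-1}(a u) du` for `a > 0`, and for `a = 0` its limit
as `a → 0`, in which `a^(1-N) I_{N-1}(a u)` becomes `(u / 2)^(N-1) / (N-1)!`. -/
def marcumQ (N : ℕ) (a b : ℝ) : ℝ :=
  if a = 0 then
    ∫ u in Set.Ioi b,
      u ^ (2 * N - 1) / (2 ^ (N - 1) * ((N - 1).factorial : ℝ)) * Real.exp (-u ^ 2 / 2)
  else
    ∫ u in Set.Ioi b,
      u * (u / a) ^ (N - 1) * Real.exp (-(u ^ 2 + a ^ 2) / 2) * besselI (N - 1) (a * u)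

/-- The integrand of the outage probability: the density of the gain of the first port at `t`
times the conditional probability that the `M - 1` other gains stay below `γth`. -/
def outageIntegrand (M N : ℕ) (σ ρ γth t : ℝ) : ℝ :=
  t ^ (N - 1) / (σ ^ (2 * N) * ((N - 1).factorial : ℝ)) * Real.exp (-t / σ ^ 2)
    * (1 - marcumQ N (√(2 * ρ ^ 2 * t / (σ ^ 2 * (1 - ρ ^ 2))))
        (√(2 * γth / (σ ^ 2 * (1 - ρ ^ 2))))) ^ (M - 1)

end

/-! Collect the real and imaginary Gaussians of port `m` into a vector `z_m` of `2 N` coordinates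
and put `κ = ρ / √(1 - ρ²)`. The gain of the first port is `σ² |z_0|²`, and each other gain is `σ²
(1 - ρ²) |z_m + κ z_0|²`. Given `z_0`, these other gains are independent and identically
distributed, with a law depending only on `κ² |z_0|²`, so the outage probability is the integral of
a distribution function to the power `M - 1` against the law of `|z_0|²`.

Two facts make this explicit. `map_sqDist_gaussianVec` identifies the law of `|z + c|²` by its
characteristic function: a product of one-dimensional Gaussian integrals on one side, a termwise
Laplace transform of the Bessel series on the other. `marcumQ_eq` recognises the Marcum function as
the tail of that law, through `x = u² / 2`. The conditioning is `pi_gaussianVec_real_eq`. -/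

/-- The entire function `∑ⱼ yʲ / (j! (k + j)!)`, which is `(z / 2)⁻ᵏ I_k(z)` at `y = z² / 4`. -/
noncomputable def besselSeries (k : ℕ) (y : ℝ) : ℝ :=
  ∑' j : ℕ, y ^ j / ((j.factorial : ℝ) * ((k + j).factorial : ℝ))

theorem summable_besselSeries (k : ℕ) (y : ℝ) :
    Summable fun j : ℕ => y ^ j / ((j.factorial : ℝ) * ((k + j).factorial : ℝ)) := by
  refine Summable.of_norm_bounded (Real.summable_pow_div_factorial |y|) fun j => ?_
  rw [norm_div, norm_pow, Real.norm_eq_abs, Real.norm_of_nonneg (by positivity)]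
  gcongr
  have : (1 : ℝ) ≤ ((k + j).factorial : ℝ) := by exact_mod_cast (k + j).factorial_pos
  nlinarith [(Nat.cast_pos (α := ℝ)).2 j.factorial_pos]

theorem besselSeries_nonneg (k : ℕ) {y : ℝ} (hy : 0 ≤ y) : 0 ≤ besselSeries k y :=
  tsum_nonneg fun j => by positivity

theorem besselSeries_zero (k : ℕ) : besselSeries k 0 = ((k.factorial : ℝ))⁻¹ := by
  rw [besselSeries, tsum_eq_single 0 (fun j hj => by simp [hj])]
  simp

@[fun_prop]
theorem measurable_besselSeries (k : ℕ) : Measurable (besselSeries k) := by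
  refine measurable_of_tendsto_metrizable
    (f := fun n y => ∑ j ∈ Finset.range n, y ^ j / ((j.factorial : ℝ) * ((k + j).factorial : ℝ)))
    (fun n => by fun_prop) ?_
  rw [tendsto_pi_nhds]
  exact fun y => (summable_besselSeries k y).hasSum.tendsto_sum_nat

theorem besselI_eq (k : ℕ) (z : ℝ) :
    besselI k z = (z / 2) ^ k * besselSeries k (z ^ 2 / 4) := by
  rw [besselI, besselSeries, ← tsum_mul_left]
  refine tsum_congr fun j => ?_
  rw [pow_add, pow_mul, add_comm k j]
  ring

theorem integrableOn_pow_mul_cexp (n : ℕ) {r : ℂ} (hr : 0 < r.re) :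
    IntegrableOn (fun x : ℝ => (x : ℂ) ^ n * Complex.exp (-r * x)) (Set.Ioi 0) := by
  have h := integrableOn_rpow_mul_exp_neg_mul_rpow (s := n) (p := 1) (b := r.re)
    (by have : (0 : ℝ) ≤ n := n.cast_nonneg
        linarith) one_pos hr
  refine Integrable.mono' h (by fun_prop) ?_
  filter_upwards [ae_restrict_mem measurableSet_Ioi] with x hx
  rw [norm_mul, norm_pow, Complex.norm_real, Real.norm_of_nonneg (le_of_lt hx), Complex.norm_exp]
  simp

/-- Integrating the derivative of `x^(n+1) e^(-r x)` over the half-line gives the recursion in `n`.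
-/
theorem integral_pow_mul_cexp (n : ℕ) {r : ℂ} (hr : 0 < r.re) :
    ∫ x : ℝ in Set.Ioi 0, (x : ℂ) ^ n * Complex.exp (-r * x) = (1 / r) ^ (n + 1) * n.factorial := by
  have hr0 : r ≠ 0 := fun h => by simp [h] at hr
  induction n with
  | zero =>
    have h := integral_exp_mul_complex_Ioi (a := -r) (by simpa) 0
    simpa using h
  | succ n ih =>
    have hi := integrableOn_pow_mul_cexp n hr
    have hi' := integrableOn_pow_mul_cexp (n + 1) hr
    have hd : ∀ x ∈ Set.Ici (0 : ℝ),
        HasDerivAt (fun x : ℝ => (x : ℂ) ^ (n + 1) * Complex.exp (-r * x))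
          ((n + 1) * ((x : ℂ) ^ n * Complex.exp (-r * x))
            - r * ((x : ℂ) ^ (n + 1) * Complex.exp (-r * x))) x := fun x _ => by
      have h1 : HasDerivAt (fun z : ℂ => z ^ (n + 1) * Complex.exp (-r * z))
          (((n + 1 : ℕ) * (x : ℂ) ^ n) * Complex.exp (-r * x)
            + (x : ℂ) ^ (n + 1) * (Complex.exp (-r * x) * (-r * 1))) x :=
        (hasDerivAt_pow (n + 1) (x : ℂ)).mul (((hasDerivAt_id (x : ℂ)).const_mul (-r)).cexp)
      convert h1.comp_ofReal using 1
      push_cast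
      ring
    have hf' : IntegrableOn (fun x : ℝ => (n + 1) * ((x : ℂ) ^ n * Complex.exp (-r * x))
        - r * ((x : ℂ) ^ (n + 1) * Complex.exp (-r * x))) (Set.Ioi 0) :=
      (hi.const_mul _).sub (hi'.const_mul _)
    have hlim := tendsto_zero_of_hasDerivAt_of_integrableOn_Ioi
      (fun x hx => hd x (Set.Ioi_subset_Ici_self hx)) hf' hi'
    have h := integral_Ioi_of_hasDerivAt_of_tendsto' hd hf' hlim
    rw [integral_sub (hi.const_mul _) (hi'.const_mul _), integral_const_mul, integral_const_mul,
      ih] at h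
    simp only [Complex.ofReal_zero, ne_eq, Nat.add_eq_zero_iff, one_ne_zero, and_false,
      not_false_eq_true, zero_pow, zero_mul, sub_zero] at h
    rw [sub_eq_zero] at h
    rw [← mul_right_inj' hr0, ← h, Nat.factorial_succ]
    push_cast
    rw [pow_succ (1 / r) (n + 1)]
    field_simp

/-- Integrating termwise, the `(k + j)!` from the power integral cancels the one in the series and
leaves the exponential series of `l / r`. A complex `r` is needed to reach characteristic functions.
-/
theorem integral_besselSeries_mul_cexp (k : ℕ) {l : ℝ} (hl : 0 ≤ l) {r : ℂ} (hr : 0 < r.re) :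
    ∫ x : ℝ in Set.Ioi 0, ((x ^ k * besselSeries k (l * x) : ℝ) : ℂ) * Complex.exp (-r * x)
      = (1 / r) ^ (k + 1) * Complex.exp (l / r) := by
  set F : ℕ → ℝ → ℂ := fun j x =>
    ((l ^ j / (j.factorial * (k + j).factorial) : ℝ) : ℂ) *
      ((x : ℂ) ^ (k + j) * Complex.exp (-r * x)) with hF
  have hint (j : ℕ) : IntegrableOn (F j) (Set.Ioi 0) :=
    (integrableOn_pow_mul_cexp (k + j) hr).const_mul _
  have hr' : 0 < ((r.re : ℝ) : ℂ).re := by simpa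
  have hnorm (j : ℕ) : ∫ x in Set.Ioi 0, ‖F j x‖
      = (1 / r.re) ^ (k + 1) * ((l / r.re) ^ j / j.factorial) := by
    have h1 : ∫ x in Set.Ioi 0, ‖F j x‖ = ∫ x : ℝ in Set.Ioi 0,
        (l ^ j / (j.factorial * (k + j).factorial)) * (x ^ (k + j) * Real.exp (-r.re * x)) := by
      refine setIntegral_congr_fun measurableSet_Ioi fun x hx => ?_
      simp only [hF]
      rw [norm_mul, norm_mul, norm_pow, Complex.norm_real, Complex.norm_real,
        Real.norm_of_nonneg (le_of_lt hx), Complex.norm_exp, Real.norm_of_nonneg (by positivity)]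
      simp
    have h2 := integral_pow_mul_cexp (k + j) hr'
    have h3 : ∫ x : ℝ in Set.Ioi 0, x ^ (k + j) * Real.exp (-r.re * x)
        = (1 / r.re) ^ (k + j + 1) * (k + j).factorial := by
      apply Complex.ofReal_injective
      rw [← integral_complex_ofReal]
      push_cast at h2 ⊢
      exact h2
    rw [h1, integral_const_mul, h3]
    have := Nat.factorial_ne_zero (k + j)
    field_simp
    ring
  have hsum := hasSum_integral_of_summable_integral_norm hint (by
    simp_rw [hnorm]
    exact (Real.summable_pow_div_factorial _).mul_left _)
  have hval (j : ℕ) : ∫ x in Set.Ioi 0, F j x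
      = (1 / r) ^ (k + 1) * ((l / r) ^ j / j.factorial) := by
    have hr0 : r ≠ 0 := fun h => by simp [h] at hr
    simp only [hF]
    rw [integral_const_mul, integral_pow_mul_cexp _ hr]
    have : ((k + j).factorial : ℂ) ≠ 0 := by exact_mod_cast Nat.factorial_ne_zero (k + j)
    have : (j.factorial : ℂ) ≠ 0 := by exact_mod_cast Nat.factorial_ne_zero j
    push_cast
    field_simp
    ring
  have hexp : HasSum (fun j : ℕ => (1 / r) ^ (k + 1) * ((l / r) ^ j / j.factorial))
      ((1 / r) ^ (k + 1) * Complex.exp (l / r)) := by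
    refine HasSum.mul_left _ ?_
    rw [Complex.exp_eq_exp_ℂ]
    exact NormedSpace.expSeries_div_hasSum_exp _
  simp_rw [hval] at hsum
  rw [hexp.unique hsum]
  refine setIntegral_congr_fun measurableSet_Ioi fun x _ => ?_
  simp only [besselSeries, hF]
  rw [← tsum_mul_left, Complex.ofReal_tsum, ← tsum_mul_right]
  refine tsum_congr fun j => ?_
  push_cast
  ring

/-! ### The noncentral chi-squared law and its characteristic function -/

/-- The density on `(0, ∞)` of the law of `∑ᵢ (zᵢ + cᵢ)²` for `2 (k + 1)` independent centred
Gaussian variables `zᵢ` of variance `1 / 2`, where `l = ∑ᵢ cᵢ²`. -/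
noncomputable def noncentralDensity (k : ℕ) (l x : ℝ) : ℝ :=
  Real.exp (-l - x) * (x ^ k * besselSeries k (l * x))

/-- The noncentral chi-squared law with `2 (k + 1)` degrees of freedom, scaled by `1 / 2`. -/
noncomputable def noncentralLaw (k : ℕ) (l : ℝ) : Measure ℝ :=
  (volume.restrict (Set.Ioi 0)).withDensity fun x => ENNReal.ofReal (noncentralDensity k l x)

@[fun_prop]
theorem measurable_noncentralDensity (k : ℕ) (l : ℝ) : Measurable (noncentralDensity k l) := by
  unfold noncentralDensity
  fun_prop

theorem noncentralDensity_nonneg (k : ℕ) {l x : ℝ} (hl : 0 ≤ l) (hx : 0 ≤ x) :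
    0 ≤ noncentralDensity k l x := by
  have := besselSeries_nonneg k (mul_nonneg hl hx)
  unfold noncentralDensity
  positivity

/-- The factors `e^(-x)` and `e^(i s x)` combine into `e^(-r x)` with `r = 1 - i s`. -/
theorem integral_noncentralDensity_mul_cexp (k : ℕ) {l : ℝ} (hl : 0 ≤ l) (s : ℝ) :
    ∫ x : ℝ in Set.Ioi 0, (noncentralDensity k l x : ℂ) * Complex.exp (s * x * Complex.I)
      = (1 / (1 - s * Complex.I)) ^ (k + 1)
        * Complex.exp (l * (s * Complex.I / (1 - s * Complex.I))) := by
  have hr : 0 < (1 - s * Complex.I).re := by simp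
  have hr0 : (1 - s * Complex.I) ≠ 0 := fun h => by simp [h] at hr
  have h := congrArg (fun z => Complex.exp (-l) * z) (integral_besselSeries_mul_cexp k hl hr)
  rw [← integral_const_mul] at h
  rw [mul_left_comm, ← Complex.exp_add] at h
  have e : -(l : ℂ) + l / (1 - s * Complex.I) = l * (s * Complex.I / (1 - s * Complex.I)) := by
    field_simp
    ring
  rw [e] at h
  rw [← h]
  refine setIntegral_congr_fun measurableSet_Ioi fun x _ => ?_
  simp only [noncentralDensity]
  push_cast
  have : Complex.exp (-l - x) * Complex.exp (s * x * Complex.I)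
      = Complex.exp (-l) * Complex.exp (-(1 - s * Complex.I) * x) := by
    rw [← Complex.exp_add, ← Complex.exp_add]
    ring_nf
  linear_combination ((x : ℂ) ^ k * (besselSeries k (l * x) : ℂ)) * this

theorem integral_noncentralDensity (k : ℕ) {l : ℝ} (hl : 0 ≤ l) :
    ∫ x in Set.Ioi 0, noncentralDensity k l x = 1 := by
  have h := integral_noncentralDensity_mul_cexp k hl 0
  apply Complex.ofReal_injective
  rw [← integral_complex_ofReal]
  simpa using h

theorem integrableOn_noncentralDensity (k : ℕ) {l : ℝ} (hl : 0 ≤ l) :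
    IntegrableOn (noncentralDensity k l) (Set.Ioi 0) :=
  -- The Bochner integral of a non-integrable function is `0`, so the value `1` forces
  -- integrability.
  Integrable.of_integral_ne_zero (by simp [integral_noncentralDensity k hl])

theorem isProbabilityMeasure_noncentralLaw (k : ℕ) {l : ℝ} (hl : 0 ≤ l) :
    IsProbabilityMeasure (noncentralLaw k l) := by
  constructor
  rw [noncentralLaw, withDensity_apply _ .univ, Measure.restrict_univ,
    ← ofReal_integral_eq_lintegral_ofReal (integrableOn_noncentralDensity k hl),
    integral_noncentralDensity k hl, ENNReal.ofReal_one]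
  filter_upwards [ae_restrict_mem measurableSet_Ioi] with x hx
  exact noncentralDensity_nonneg k hl (le_of_lt hx)

theorem setIntegral_noncentralLaw {E : Type*} [NormedAddCommGroup E] [NormedSpace ℝ E]
    (k : ℕ) {l : ℝ} (hl : 0 ≤ l) (f : ℝ → E) {s : Set ℝ} (hs : MeasurableSet s) :
    ∫ x in s, f x ∂(noncentralLaw k l)
      = ∫ x in s ∩ Set.Ioi 0, noncentralDensity k l x • f x := by
  rw [noncentralLaw, setIntegral_withDensity_eq_setIntegral_toReal_smul (by fun_prop)
    (ae_of_all _ fun _ => ENNReal.ofReal_lt_top) _ hs, Measure.restrict_restrict hs]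
  refine setIntegral_congr_fun (hs.inter measurableSet_Ioi) fun x hx => ?_
  rw [ENNReal.toReal_ofReal (noncentralDensity_nonneg k hl (le_of_lt hx.2))]

theorem charFun_noncentralLaw (k : ℕ) {l : ℝ} (hl : 0 ≤ l) (s : ℝ) :
    charFun (noncentralLaw k l) s = (1 / (1 - s * Complex.I)) ^ (k + 1)
        * Complex.exp (l * (s * Complex.I / (1 - s * Complex.I))) := by
  rw [charFun_apply_real, ← setIntegral_univ, setIntegral_noncentralLaw k hl _ .univ,
    Set.univ_inter, ← integral_noncentralDensity_mul_cexp k hl s]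
  simp

/-! ### Squared norms of shifted Gaussian vectors -/

theorem integral_cexp_sq_gaussianReal (c s : ℝ) :
    ∫ x, Complex.exp (s * ((x + c) ^ 2 : ℝ) * Complex.I) ∂(gaussianReal 0 (1 / 2))
      = ((√Real.pi)⁻¹ : ℝ) * (Real.pi / (1 - s * Complex.I)) ^ (1 / 2 : ℂ)
        * Complex.exp ((c ^ 2 : ℝ) * (s * Complex.I / (1 - s * Complex.I))) := by
  have hr : (-(1 - s * Complex.I)).re < 0 := by simp
  have hr0 : (1 - s * Complex.I) ≠ 0 := fun h => by simp [h] at hr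
  rw [integral_gaussianReal_eq_integral_smul (by norm_num)]
  have h := integral_cexp_quadratic hr (2 * s * c * Complex.I) (s * c ^ 2 * Complex.I)
  have e1 (x : ℝ) : gaussianPDFReal 0 (1 / 2) x • Complex.exp (s * ((x + c) ^ 2 : ℝ) * Complex.I)
      = ((√Real.pi)⁻¹ : ℝ) * Complex.exp (-(1 - s * Complex.I) * x ^ 2
        + 2 * s * c * Complex.I * x + s * c ^ 2 * Complex.I) := by
    have e2 : gaussianPDFReal 0 (1 / 2) x = (√Real.pi)⁻¹ * Real.exp (-x ^ 2) := by
      norm_num [gaussianPDFReal]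
      field_simp
    rw [e2, Complex.real_smul, Complex.ofReal_mul, mul_assoc, Complex.ofReal_exp,
      ← Complex.exp_add]
    push_cast
    ring_nf
  simp_rw [e1]
  rw [integral_const_mul, h, ← mul_assoc, neg_neg]
  congr 2
  push_cast
  field_simp
  ring

/-- The number of coordinates is even, so the complex square roots pair up and no choice of branch
survives. -/
theorem sqrt_pi_inv_mul_cpow_sq (w : ℂ) :
    (((√Real.pi)⁻¹ : ℝ) * (Real.pi / w) ^ (1 / 2 : ℂ)) ^ 2 = 1 / w := by
  have h : ((Real.pi / w) ^ (1 / 2 : ℂ)) ^ 2 = Real.pi / w := by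
    rw [one_div]
    exact Complex.cpow_ofNat_inv_pow _ 2
  have hpi : (Real.pi : ℂ) ≠ 0 := by exact_mod_cast Real.pi_ne_zero
  rw [mul_pow, h, ← Complex.ofReal_pow, inv_pow, Real.sq_sqrt Real.pi_pos.le]
  push_cast
  field_simp

/-- The squared Euclidean distance of `z` from `-c`. -/
def sqDist {ι : Type*} [Fintype ι] (c z : ι → ℝ) : ℝ := ∑ i, (z i + c i) ^ 2

/-- The law of independent centred Gaussian variables of variance `1 / 2`. -/
noncomputable def gaussianVec (ι : Type*) [Fintype ι] : Measure (ι → ℝ) :=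
  Measure.pi fun _ => gaussianReal 0 (1 / 2)

instance (ι : Type*) [Fintype ι] : IsProbabilityMeasure (gaussianVec ι) := by
  unfold gaussianVec
  infer_instance

@[fun_prop]
theorem measurable_sqDist {ι : Type*} [Fintype ι] :
    Measurable fun p : (ι → ℝ) × (ι → ℝ) => sqDist p.1 p.2 := by
  unfold sqDist
  fun_prop

theorem map_sqDist_gaussianVec {ι : Type*} [Fintype ι] (k : ℕ)
    (hι : Fintype.card ι = 2 * (k + 1)) (c : ι → ℝ) :
    (gaussianVec ι).map (sqDist c) = noncentralLaw k (∑ i, c i ^ 2) := by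
  have hl : 0 ≤ ∑ i, c i ^ 2 := by positivity
  have := isProbabilityMeasure_noncentralLaw k hl
  have hm : Measurable (sqDist c) := by fun_prop
  refine Measure.ext_of_charFun (funext fun s => ?_)
  rw [charFun_noncentralLaw k hl, charFun_apply_real, integral_map hm.aemeasurable (by fun_prop)]
  have e (z : ι → ℝ) : Complex.exp (s * sqDist c z * Complex.I)
      = ∏ i, Complex.exp (s * ((z i + c i) ^ 2 : ℝ) * Complex.I) := by
    rw [← Complex.exp_sum, sqDist]
    push_cast
    rw [Finset.mul_sum, Finset.sum_mul]
  simp_rw [e]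
  rw [gaussianVec, integral_fintype_prod_eq_prod
    (f := fun i (x : ℝ) => Complex.exp (s * ((x + c i) ^ 2 : ℝ) * Complex.I))]
  simp_rw [integral_cexp_sq_gaussianReal]
  rw [Finset.prod_mul_distrib, ← Complex.exp_sum, ← Finset.sum_mul, Finset.prod_const,
    Finset.card_univ, hι, pow_mul, sqrt_pi_inv_mul_cpow_sq]
  push_cast
  rfl

/-! ### The Marcum function as a tail probability -/

theorem marcumQ_eq (N : ℕ) (hN : 1 ≤ N) {a b : ℝ} (hb : 0 ≤ b) :
    marcumQ N a b = ∫ x in Set.Ioi (b ^ 2 / 2), noncentralDensity (N - 1) (a ^ 2 / 2) x := by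
  obtain ⟨k, rfl⟩ : ∃ k, N = k + 1 := ⟨N - 1, by omega⟩
  have h1 : marcumQ (k + 1) a b
      = ∫ u in Set.Ioi b, u * noncentralDensity k (a ^ 2 / 2) (u ^ 2 / 2) := by
    unfold marcumQ
    split_ifs with h0
    · refine setIntegral_congr_fun measurableSet_Ioi fun u _ => ?_
      have e : 2 * (k + 1) - 1 = 2 * k + 1 := by omega
      simp only [noncentralDensity, h0, e, Nat.add_sub_cancel]
      norm_num [besselSeries_zero, pow_succ, pow_mul, div_pow]
      field_simp
    · refine setIntegral_congr_fun measurableSet_Ioi fun u _ => ?_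
      simp only [noncentralDensity, besselI_eq, Nat.add_sub_cancel]
      have e1 : (a * u) ^ 2 / 4 = a ^ 2 / 2 * (u ^ 2 / 2) := by ring
      have e2 : -(u ^ 2 + a ^ 2) / 2 = -(a ^ 2 / 2) - u ^ 2 / 2 := by ring
      have e3 : (u / a) ^ k * (a * u / 2) ^ k = (u ^ 2 / 2) ^ k := by
        rw [← mul_pow]
        congr 1
        field_simp
      rw [e1, e2, ← e3]
      ring
  -- The substitution `x = u² / 2` is done as `y = u²` followed by a scaling; the `1 / 2` in `g`
  -- cancels the `2` of the derivative `2 u`.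
  have h2 := integral_comp_rpow_Ioi_of_pos'
    (g := fun y => (1 / 2) * noncentralDensity k (a ^ 2 / 2) (1 / 2 * y)) two_pos (sq_nonneg b)
  rw [integral_const_mul, integral_comp_mul_left_Ioi _ _ (by norm_num : (0 : ℝ) < 1 / 2)] at h2
  have e : (b ^ 2) ^ (2 : ℝ)⁻¹ = b := by
    rw [← Real.rpow_natCast_mul hb]
    norm_num
  rw [e] at h2
  rw [h1, Nat.add_sub_cancel, div_eq_inv_mul (b ^ 2), ← one_div]
  calc _ = _ := ?_
    _ = _ := h2
    _ = _ := by rw [smul_eq_mul]; ring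
  refine setIntegral_congr_fun measurableSet_Ioi fun u _ => ?_
  simp only [smul_eq_mul]
  rw [div_eq_inv_mul (u ^ 2), ← one_div, Real.rpow_two, show (2 : ℝ) - 1 = 1 by norm_num,
    Real.rpow_one]
  ring

theorem one_sub_marcumQ_eq {ι : Type*} [Fintype ι] (N : ℕ) (hN : 1 ≤ N)
    (hι : Fintype.card ι = 2 * N) {a b : ℝ} (hb : 0 ≤ b) (c : ι → ℝ)
    (hc : ∑ i, c i ^ 2 = a ^ 2 / 2) :
    1 - marcumQ N a b = (gaussianVec ι).real {z | sqDist c z < b ^ 2 / 2} := by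
  have hl : 0 ≤ a ^ 2 / 2 := by positivity
  have hB : 0 ≤ b ^ 2 / 2 := by positivity
  have hm : Measurable (sqDist c) := by fun_prop
  have hlaw := map_sqDist_gaussianVec (N - 1) (by omega) c
  have h1 : (gaussianVec ι).real {z | sqDist c z < b ^ 2 / 2}
      = (noncentralLaw (N - 1) (a ^ 2 / 2)).real (Set.Iio (b ^ 2 / 2)) := by
    rw [← hc, ← hlaw, map_measureReal_apply hm measurableSet_Iio]
    rfl
  have h2 := setIntegral_noncentralLaw (N - 1) hl (fun _ => (1 : ℝ))
    (measurableSet_Iio (a := b ^ 2 / 2))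
  simp only [integral_const, smul_eq_mul, mul_one, measureReal_restrict_apply .univ,
    Set.univ_inter] at h2
  rw [h1, h2, marcumQ_eq N hN hb, ← integral_noncentralDensity (N - 1) hl,
    ← Set.Ioc_union_Ioi_eq_Ioi hB, setIntegral_union Set.Ioc_disjoint_Ioi_same measurableSet_Ioi,
    Set.Ioc_union_Ioi_eq_Ioi hB, Set.Iio_inter_Ioi, integral_Ioc_eq_integral_Ioo]
  · ring
  · exact (integrableOn_noncentralDensity _ hl).mono_set Set.Ioc_subset_Ioi_self
  · exact (integrableOn_noncentralDensity _ hl).mono_set (Set.Ioi_subset_Ioi hB)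

/-- A concrete shift with noncentrality `a² / 2`, so that `one_sub_marcumQ_eq` applies to every `a`.
-/
theorem sum_const_sq_eq (N : ℕ) (hN : 1 ≤ N) (a : ℝ) :
    ∑ _i : Fin (2 * N), (a / (2 * √N)) ^ 2 = a ^ 2 / 2 := by
  have hN' : (0 : ℝ) < N := by exact_mod_cast hN
  simp only [div_pow, mul_pow, Real.sq_sqrt hN'.le, Finset.sum_const, Finset.card_univ,
    Fintype.card_fin, nsmul_eq_mul]
  push_cast
  field_simp

/-- The complement `1 - Q` is the measure of a slice of a measurable set in a product, hence
measurable in the base point. -/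
theorem measurable_marcumQ_comp (N : ℕ) (hN : 1 ≤ N) {b : ℝ} (hb : 0 ≤ b) {g : ℝ → ℝ}
    (hg : Measurable g) : Measurable fun s => marcumQ N (g s) b := by
  have hT : MeasurableSet {p : ℝ × (Fin (2 * N) → ℝ) |
      sqDist (fun _ => g p.1 / (2 * √N)) p.2 < b ^ 2 / 2} :=
    measurableSet_lt
      (measurable_sqDist.comp (Measurable.prodMk (by fun_prop) measurable_snd)) measurable_const
  have h := measurable_const (a := (1 : ℝ)).sub
    (measurable_measure_prodMk_left (ν := gaussianVec (Fin (2 * N))) hT).ennreal_toReal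
  convert h using 2 with s
  have h2 := one_sub_marcumQ_eq N hN (Fintype.card_fin _) hb _ (sum_const_sq_eq N hN (g s))
  rw [← sub_sub_self 1 (marcumQ N (g s) b), h2]
  rfl

theorem one_sub_marcumQ_mem_Icc (N : ℕ) (hN : 1 ≤ N) {a b : ℝ} (hb : 0 ≤ b) :
    1 - marcumQ N a b ∈ Set.Icc 0 1 := by
  rw [one_sub_marcumQ_eq N hN (Fintype.card_fin _) hb _ (sum_const_sq_eq N hN a)]
  exact ⟨measureReal_nonneg, measureReal_le_one⟩

/-! ### From SNR to channel gains -/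

theorem receivedSNR_eq {N : ℕ} (P η₀ : ℝ) (h : Fin N → ℂ) :
    receivedSNR P η₀ h = P * precodingGain h / η₀ ^ 2 := by
  have h1 : precodingGain h = ‖WithLp.toLp 2 h‖ ^ 2 := by
    rw [EuclideanSpace.norm_sq_eq]
    rfl
  have h2 : mrtPrecoder h ⬝ᵥ h = ((precodingGain h / ‖WithLp.toLp 2 h‖ : ℝ) : ℂ) := by
    simp only [dotProduct, mrtPrecoder, precodingGain]
    push_cast
    rw [Finset.sum_div]
    refine Finset.sum_congr rfl fun n _ => ?_
    rw [div_mul_eq_mul_div, ← Complex.conj_mul']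
    rfl
  rw [receivedSNR, h2, Complex.norm_real, Real.norm_eq_abs, sq_abs, h1]
  congr 2
  -- For a zero channel, division by zero makes the precoder `0`, and both sides vanish.
  rcases eq_or_ne ‖WithLp.toLp 2 h‖ 0 with h0 | h0
  · simp [h0]
  · field_simp

theorem fasSNR_lt_iff {M N : ℕ} [NeZero M] {P η₀ σ : ℝ} (hP : 0 < P) (hη : 0 < η₀) (hσ : 0 < σ)
    (γ : ℝ) (h : Fin M → Fin N → ℂ) :
    fasSNR P η₀ h / averageSNR P η₀ σ < γ / σ ^ 2 ↔ fasGain h < γ := by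
  have hav : 0 < averageSNR P η₀ σ := by
    unfold averageSNR
    positivity
  rw [div_lt_iff₀ hav, fasSNR, fasGain, Finset.sup'_lt_iff, Finset.sup'_lt_iff]
  refine forall₂_congr fun m _ => ?_
  have e : γ / σ ^ 2 * averageSNR P η₀ σ = P * γ / η₀ ^ 2 := by
    unfold averageSNR
    field_simp
  rw [receivedSNR_eq, e, div_lt_div_iff_of_pos_right (by positivity), mul_lt_mul_iff_right₀ hP]

/-! ### The ports as independent Gaussian vectors -/

/-- The `2 N` real Gaussian variables attached to each port. -/
def portVec {Ω : Type*} {M N : ℕ} (x y : Fin M → Fin N → Ω → ℝ) (ω : Ω) (m : Fin M) :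
    Fin N ⊕ Fin N → ℝ :=
  Sum.elim (fun n => x m n ω) fun n => y m n ω

theorem hasLaw_portVec {Ω : Type*} [MeasurableSpace Ω] {μ : Measure Ω} [IsProbabilityMeasure μ]
    {M N : ℕ} {x y : Fin M → Fin N → Ω → ℝ}
    (hx : ∀ m n, HasLaw (x m n) (gaussianReal 0 (1 / 2)) μ)
    (hy : ∀ m n, HasLaw (y m n) (gaussianReal 0 (1 / 2)) μ)
    (hxy : iIndepFun
      (Sum.elim (fun i : Fin M × Fin N => x i.1 i.2) (fun i : Fin M × Fin N => y i.1 i.2)) μ) :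
    HasLaw (portVec x y) (Measure.pi fun _ : Fin M => gaussianVec (Fin N ⊕ Fin N)) μ := by
  let g : (_ : Fin M) × (Fin N ⊕ Fin N) → (Fin M × Fin N) ⊕ (Fin M × Fin N) :=
    fun p => Sum.map (Prod.mk p.1) (Prod.mk p.1) p.2
  have hg : g.Injective := by
    rintro ⟨m, n | n⟩ ⟨m', n' | n'⟩ h <;> simp_all [g]
  let X : (_ : Fin M) × (Fin N ⊕ Fin N) → Ω → ℝ := fun p ω => portVec x y ω p.1 p.2
  have hX (p) : HasLaw (X p) (gaussianReal 0 (1 / 2)) μ := by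
    obtain ⟨m, n | n⟩ := p
    · exact hx m n
    · exact hy m n
  have hind : iIndepFun X μ := by
    have h := hxy.precomp hg
    have e : X = fun p => (Sum.elim (fun i : Fin M × Fin N => x i.1 i.2)
        (fun i : Fin M × Fin N => y i.1 i.2)) (g p) := by
      ext ⟨m, n | n⟩ ω <;> rfl
    rw [e]
    exact h
  have hXm : AEMeasurable (fun ω p => X p ω) μ :=
    aemeasurable_pi_lambda _ fun p => (hX p).aemeasurable
  have hmap := hind.hasLaw_infinitePi hX hXm
  -- Currying regroups the product over pairs (port, coordinate) into a product over ports of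
  -- `gaussianVec`.
  have h := (HasLaw.mk (μ := Measure.infinitePi fun m : Fin M => Measure.infinitePi
    fun _ : Fin N ⊕ Fin N => gaussianReal 0 (1 / 2)) (MeasurableEquiv.measurable _).aemeasurable
    (Measure.infinitePi_map_piCurry
      fun (_ : Fin M) (_ : Fin N ⊕ Fin N) => gaussianReal 0 (1 / 2))).comp hmap
  simp only [Measure.infinitePi_eq_pi] at h
  exact h

theorem precodingGain_channel_zero {Ω : Type*} {M N : ℕ} [NeZero M] (σ ρ : ℝ)
    (x y : Fin M → Fin N → Ω → ℝ) (ω : Ω) :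
    precodingGain (channel σ ρ x y ω 0) = σ ^ 2 * sqDist 0 (portVec x y ω 0) := by
  simp only [precodingGain, channel, if_true, sqDist, portVec, Fintype.sum_sum_type, Sum.elim_inl,
    Sum.elim_inr, Pi.zero_apply, add_zero, ← Finset.sum_add_distrib, Finset.mul_sum]
  refine Finset.sum_congr rfl fun n _ => ?_
  rw [mul_comm Complex.I, Complex.sq_norm, Complex.normSq_add_mul_I]
  ring

theorem precodingGain_channel_of_ne_zero {Ω : Type*} {M N : ℕ} [NeZero M] (σ : ℝ) {ρ : ℝ}
    (hρ : |ρ| < 1) (x y : Fin M → Fin N → Ω → ℝ) (ω : Ω) {m : Fin M} (hm : m ≠ 0) :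
    precodingGain (channel σ ρ x y ω m) = σ ^ 2 * (1 - ρ ^ 2) *
      sqDist ((ρ / √(1 - ρ ^ 2)) • portVec x y ω 0) (portVec x y ω m) := by
  have h : 0 < 1 - ρ ^ 2 := by
    have := (sq_lt_one_iff_abs_lt_one ρ).2 hρ
    linarith
  simp only [precodingGain, channel, if_neg hm, sqDist, portVec, Fintype.sum_sum_type,
    Sum.elim_inl, Sum.elim_inr, Pi.smul_apply, smul_eq_mul, ← Finset.sum_add_distrib,
    Finset.mul_sum]
  refine Finset.sum_congr rfl fun n _ => ?_
  rw [mul_comm Complex.I, Complex.sq_norm, Complex.normSq_add_mul_I]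
  have hs : √(1 - ρ ^ 2) ≠ 0 := (Real.sqrt_pos.2 h).ne'
  have e (u v : ℝ) : (σ * (√(1 - ρ ^ 2) * u + ρ * v)) ^ 2
      = σ ^ 2 * (1 - ρ ^ 2) * (u + ρ / √(1 - ρ ^ 2) * v) ^ 2 := by
    nth_rw 2 [← Real.sq_sqrt h.le]
    field_simp
  rw [e, e]
  ring

/-! ### Conditioning on the first port -/

theorem pi_gaussianVec_real_eq {ι : Type*} [Fintype ι] (M : ℕ) {N : ℕ} (hN : 1 ≤ N)
    (hι : Fintype.card ι = 2 * N) (κ : ℝ) (A : ℝ) {B : ℝ} (hB : 0 ≤ B) :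
    (Measure.pi fun _ : Fin (M + 1) => gaussianVec ι).real
        {f | sqDist 0 (f 0) < A ∧ ∀ m : Fin M, sqDist (κ • f 0) (f m.succ) < B}
      = ∫ s in Set.Ioo 0 A, noncentralDensity (N - 1) 0 s
          * (1 - marcumQ N (√(2 * κ ^ 2 * s)) (√(2 * B))) ^ M := by
  set G : ℝ → ℝ := fun s => (1 - marcumQ N (√(2 * κ ^ 2 * s)) (√(2 * B))) ^ M with hG
  have hGm : Measurable G :=
    (measurable_const.sub (measurable_marcumQ_comp N hN (Real.sqrt_nonneg _)
      (g := fun s => √(2 * κ ^ 2 * s)) (by fun_prop))).pow_const M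
  let T : Set ((ι → ℝ) × (Fin M → ι → ℝ)) :=
    {p | sqDist 0 p.1 < A ∧ ∀ m : Fin M, sqDist (κ • p.1) (p.2 m) < B}
  have hT : MeasurableSet T := by
    have e : T = {p | sqDist 0 p.1 < A} ∩ ⋂ m, {p | sqDist (κ • p.1) (p.2 m) < B} := by
      ext
      simp [T]
    rw [e]
    exact (measurableSet_lt (by fun_prop) measurable_const).inter
      (MeasurableSet.iInter fun m => measurableSet_lt (by fun_prop) measurable_const)
  have hmp := measurePreserving_piFinSuccAbove (fun _ : Fin (M + 1) => gaussianVec ι) 0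
  have h1 : (Measure.pi fun _ : Fin (M + 1) => gaussianVec ι).real
        {f | sqDist 0 (f 0) < A ∧ ∀ m : Fin M, sqDist (κ • f 0) (f m.succ) < B}
      = ((gaussianVec ι).prod (Measure.pi fun _ : Fin M => gaussianVec ι)).real T := by
    rw [← hmp.measureReal_preimage hT.nullMeasurableSet]
    rfl
  have h2 (z : ι → ℝ) : (Measure.pi fun _ : Fin M => gaussianVec ι).real (Prod.mk z ⁻¹' T)
      = (Set.Iio A).indicator G (sqDist 0 z) := by
    by_cases hz : sqDist 0 z < A
    · have e : Prod.mk z ⁻¹' T = Set.univ.pi fun _ => {w | sqDist (κ • z) w < B} := by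
        ext w
        simp [T, hz]
      rw [e, measureReal_def, Measure.pi_pi, Finset.prod_const, Finset.card_univ,
        Fintype.card_fin, ENNReal.toReal_pow, Set.indicator_of_mem (Set.mem_Iio.2 hz), hG]
      have hs : 0 ≤ sqDist 0 z := by
        unfold sqDist
        positivity
      beta_reduce
      -- The Marcum arguments satisfy `a² / 2 = κ² |z|² = |κ z|²` and `b² / 2 = B`.
      rw [one_sub_marcumQ_eq N hN hι (Real.sqrt_nonneg _) (κ • z) ?_,
        Real.sq_sqrt (by positivity), mul_div_cancel_left₀ _ two_ne_zero]
      · rfl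
      · rw [Real.sq_sqrt (by positivity)]
        simp only [sqDist, Pi.smul_apply, smul_eq_mul, mul_pow, ← Finset.mul_sum, Pi.zero_apply,
          add_zero]
        ring
    · have e : Prod.mk z ⁻¹' T = ∅ := by
        ext w
        simp [T, hz]
      rw [e, measureReal_empty, Set.indicator_of_notMem (mt Set.mem_Iio.1 hz)]
  have hlaw := map_sqDist_gaussianVec (N - 1) (by omega) (0 : ι → ℝ)
  simp only [Pi.zero_apply, ne_eq, OfNat.ofNat_ne_zero, not_false_eq_true, zero_pow,
    Finset.sum_const_zero] at hlaw
  have hm : Measurable (sqDist (0 : ι → ℝ)) := by fun_prop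
  rw [h1, measureReal_def, Measure.prod_apply hT,
    ← integral_toReal (measurable_measure_prodMk_left hT).aemeasurable
      (ae_of_all _ fun _ => measure_lt_top _ _)]
  simp_rw [← measureReal_def, h2]
  rw [← integral_map hm.aemeasurable
    (hGm.indicator measurableSet_Iio).aestronglyMeasurable, hlaw,
    integral_indicator measurableSet_Iio, setIntegral_noncentralLaw _ le_rfl _ measurableSet_Iio,
    Set.Iio_inter_Ioi]
  rfl

/-- At `l = 0` the noncentral density is the Gamma density, since `besselSeries k 0 = 1 / k!`; the
factor `(σ²)⁻¹` is the Jacobian of `s = t / σ²`. -/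
theorem outageIntegrand_eq (M N : ℕ) {σ ρ : ℝ} (hσ : 0 < σ) (hρ : |ρ| < 1) (hN : 1 ≤ N)
    (γth t : ℝ) :
    outageIntegrand (M + 1) N σ ρ γth t = (σ ^ 2)⁻¹ * (noncentralDensity (N - 1) 0 (t / σ ^ 2)
      * (1 - marcumQ N (√(2 * (ρ / √(1 - ρ ^ 2)) ^ 2 * (t / σ ^ 2)))
          (√(2 * (γth / (σ ^ 2 * (1 - ρ ^ 2)))))) ^ M) := by
  obtain ⟨k, rfl⟩ : ∃ k, N = k + 1 := ⟨N - 1, by omega⟩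
  have h : 0 < 1 - ρ ^ 2 := by
    have := (sq_lt_one_iff_abs_lt_one ρ).2 hρ
    linarith
  have e : 2 * (ρ / √(1 - ρ ^ 2)) ^ 2 * (t / σ ^ 2) = 2 * ρ ^ 2 * t / (σ ^ 2 * (1 - ρ ^ 2)) := by
    rw [div_pow, Real.sq_sqrt h.le]
    field_simp
  rw [e, ← mul_div_assoc]
  simp only [outageIntegrand, noncentralDensity, Nat.add_sub_cancel, zero_mul, besselSeries_zero,
    neg_zero, zero_sub, neg_div]
  rw [← mul_assoc]
  congr 1
  have : (k.factorial : ℝ) ≠ 0 := by exact_mod_cast k.factorial_ne_zero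
  rw [div_pow, ← pow_mul, mul_add, pow_add]
  field_simp

theorem intervalIntegrable_outageIntegrand (M N : ℕ) (hN : 1 ≤ N) (σ ρ γth a b : ℝ) :
    IntervalIntegrable (outageIntegrand M N σ ρ γth) volume a b := by
  have hQ : Measurable fun t => 1 - marcumQ N (√(2 * ρ ^ 2 * t / (σ ^ 2 * (1 - ρ ^ 2))))
      (√(2 * γth / (σ ^ 2 * (1 - ρ ^ 2)))) :=
    measurable_const.sub (measurable_marcumQ_comp N hN (Real.sqrt_nonneg _)
      (g := fun t => √(2 * ρ ^ 2 * t / (σ ^ 2 * (1 - ρ ^ 2)))) (by fun_prop))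
  have hc : Continuous fun t : ℝ =>
      t ^ (N - 1) / (σ ^ (2 * N) * ((N - 1).factorial : ℝ)) * Real.exp (-t / σ ^ 2) := by
    fun_prop
  -- The power of `1 - Q` lies in `[0, 1]`, so the continuous first factor dominates.
  refine (hc.norm.intervalIntegrable a b).mono_fun' ?_ (ae_of_all _ fun t => ?_)
  · exact (hc.measurable.mul (hQ.pow_const _)).aestronglyMeasurable
  · have h := one_sub_marcumQ_mem_Icc N hN
      (a := √(2 * ρ ^ 2 * t / (σ ^ 2 * (1 - ρ ^ 2))))
      (Real.sqrt_nonneg (2 * γth / (σ ^ 2 * (1 - ρ ^ 2))))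
    simp only [outageIntegrand]
    rw [norm_mul]
    refine mul_le_of_le_one_right (norm_nonneg _) ?_
    rw [Real.norm_of_nonneg (pow_nonneg h.1 _)]
    exact pow_le_one₀ h.1 h.2

theorem theorem1 {Ω : Type*} [MeasurableSpace Ω] (μ : Measure Ω) [IsProbabilityMeasure μ]
    (M N : ℕ) [NeZero M] (hN : 1 ≤ N)
    (σ ρ γth : ℝ) (hσ : 0 < σ) (hρ : |ρ| < 1) (hγ : 0 ≤ γth)
    (x y : Fin M → Fin N → Ω → ℝ)
    (hx : ∀ m n, HasLaw (x m n) (gaussianReal 0 (1 / 2)) μ)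
    (hy : ∀ m n, HasLaw (y m n) (gaussianReal 0 (1 / 2)) μ)
    (hxy : iIndepFun
      (Sum.elim (fun i : Fin M × Fin N => x i.1 i.2) (fun i : Fin M × Fin N => y i.1 i.2)) μ) :
    (∀ P η₀ : ℝ, 0 < P → 0 < η₀ →
      {ω | fasSNR P η₀ (channel σ ρ x y ω) / averageSNR P η₀ σ < γth / σ ^ 2}
        = {ω | fasGain (channel σ ρ x y ω) < γth}) ∧
    IntervalIntegrable (outageIntegrand M N σ ρ γth) volume 0 γth ∧
    μ.real {ω | fasGain (channel σ ρ x y ω) < γth}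
      = ∫ t in (0 : ℝ)..γth, outageIntegrand M N σ ρ γth t := by
  refine ⟨fun P η₀ hP hη => Set.ext fun ω => fasSNR_lt_iff hP hη hσ _ _,
    intervalIntegrable_outageIntegrand M N hN σ ρ γth _ _, ?_⟩
  obtain ⟨M, rfl⟩ : ∃ M', M = M' + 1 := ⟨M - 1, by have := NeZero.pos M; omega⟩
  have h : 0 < 1 - ρ ^ 2 := by
    have := (sq_lt_one_iff_abs_lt_one ρ).2 hρ
    linarith
  have hσ2 : 0 < σ ^ 2 := by positivity
  have hσρ : 0 < σ ^ 2 * (1 - ρ ^ 2) := by positivity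
  let T : Set (Fin (M + 1) → Fin N ⊕ Fin N → ℝ) := {f | sqDist 0 (f 0) < γth / σ ^ 2 ∧
    ∀ m : Fin M, sqDist ((ρ / √(1 - ρ ^ 2)) • f 0) (f m.succ) < γth / (σ ^ 2 * (1 - ρ ^ 2))}
  have hset : {ω | fasGain (channel σ ρ x y ω) < γth} = portVec x y ⁻¹' T := by
    ext ω
    simp only [T, Set.mem_ofPred_eq, Set.mem_preimage, fasGain, Finset.sup'_lt_iff,
      Finset.mem_univ, true_implies]
    rw [Fin.forall_fin_succ]
    refine and_congr ?_ (forall_congr' fun m => ?_)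
    · rw [lt_div_iff₀' hσ2]
      exact iff_of_eq (congrArg (· < γth) (precodingGain_channel_zero σ ρ x y ω))
    · rw [lt_div_iff₀' hσρ]
      exact iff_of_eq (congrArg (· < γth)
        (precodingGain_channel_of_ne_zero σ hρ x y ω (Fin.succ_ne_zero m)))
  have hT : MeasurableSet T := by
    have e : T = {f | sqDist 0 (f 0) < γth / σ ^ 2} ∩ ⋂ m : Fin M,
        {f | sqDist ((ρ / √(1 - ρ ^ 2)) • f 0) (f m.succ) < γth / (σ ^ 2 * (1 - ρ ^ 2))} := by
      ext
      simp [T]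
    rw [e]
    exact (measurableSet_lt (by fun_prop) measurable_const).inter
      (MeasurableSet.iInter fun m => measurableSet_lt (by fun_prop) measurable_const)
  have hlaw := hasLaw_portVec hx hy hxy
  rw [hset, ← map_measureReal_apply_of_aemeasurable hlaw.aemeasurable hT, hlaw.map_eq,
    pi_gaussianVec_real_eq M hN (by simp [two_mul]) _ _ (by positivity)]
  simp_rw [outageIntegrand_eq M N hσ hρ hN]
  rw [intervalIntegral.integral_const_mul, intervalIntegral.integral_comp_div
    (fun s => noncentralDensity (N - 1) 0 s
      * (1 - marcumQ N (√(2 * (ρ / √(1 - ρ ^ 2)) ^ 2 * s))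
          (√(2 * (γth / (σ ^ 2 * (1 - ρ ^ 2)))))) ^ M) hσ2.ne', smul_eq_mul,
    inv_mul_cancel_left₀ hσ2.ne', zero_div,
    intervalIntegral.integral_of_le (by positivity), integral_Ioc_eq_integral_Ioo]
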